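/- Let $\rho^A$ be a quantum state (density operator: positive semidefinite, of trace one) on a finite-dimensional Hilbert space $\mathcal H_A$ of dimension $d_A$. All logarithms are to base $2$; $H(A)_\rho = -\operatorname{Tr}(\rho^A\log\rho^A)$ is the von Neumann entropy and $\|\omega\|_1=\operatorname{Tr}\sqrt{\omega^\dagger\omega}$ the trace norm. For $n\in\mathbb N$ and $\epsilon>0$, an $(n,\epsilon)$ purity concentration code for $\rho^A$ consists of finite-dimensional spaces $\mathcal H_{A_p},\mathcal H_{A_g}$ and a unitary $U:\mathcal H_A^{\otimes n}\to\mathcal H_{A_p}\otimes\mathcal H_{A_g}$ (so that $d_{A_p}d_{A_g}=d_A^n$; no ancillas are allowed) such that the state $\sigma^{A_pA_g}=U(\rho^A)^{\otimes n}U^\dagger$ has reduced state $\sigma^{A_p}=\operatorname{Tr}_{A_g}\sigma^{A_pA_g}$ with $$\big\|\sigma^{A_p}-|0\rangle\langle 0|^{A_p}\big\|_1\le\epsilon ,$$ where $|0\rangle^{A_p}$ is a fixed standard unit basis vector of $\mathcal H_{A_p}$. The rate of the code is $\frac1n\log d_{A_p}$. A real number $R$ is achievable if for all $\epsilon,\delta>0$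 and all sufficiently large $n$ there is an $(n,\epsilon)$ code of rate at least $R-\delta$. The purity $\kappa(\rho^A)$ is the supremum of all achievable rates. Theorem 1. The set of achievable rates is non-empty and bounded above, and its supremum is $$\kappa(\rho^A)=\log d_A-H(A)_\rho .$$ -/

import Mathlib

noncomputable section

namespace Purity

open scoped ComplexOrder in
/-- A quantum state on the space `ℂ^A`: a positive semidefinite matrix of trace one. -/
structure IsState {A : Type*} [Fintype A] (ρ : Matrix A A ℂ) : Prop where
  posSemidef : ρ.PosSemidef
  trace_eq_one : ρ.trace = 1

/-- The von Neumann entropy `H(ρ) = - Tr (ρ log ρ)` in qubits, i.e. with logarithms to base 2.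
The operator logarithm is taken by functional calculus; `Real.logb 2 0 = 0` gives the usual
convention `0 log 0 = 0`. -/
def entropy {A : Type*} [Fintype A] [DecidableEq A] (ρ : Matrix A A ℂ) : ℝ :=
  -((ρ * cfc (Real.logb 2) ρ).trace).re

open Matrix in
/-- The trace norm `‖ω‖₁ = Tr √(ω† ω)`, the square root being taken by functional calculus. -/
def traceNorm {A : Type*} [Fintype A] [DecidableEq A] (ω : Matrix A A ℂ) : ℝ :=
  ((cfc Real.sqrt (ωᴴ * ω)).trace).re

/-- The tensor power `ρ^{⊗ n}` on the space of `n` copies of the system, whose standard product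
basis is indexed by `Fin n → A`. -/
def tensorPow {A : Type*} (ρ : Matrix A A ℂ) (n : ℕ) : Matrix (Fin n → A) (Fin n → A) ℂ :=
  Matrix.of fun x y => ∏ k, ρ (x k) (y k)

/-- The reduced matrix `Tr_G σ` on `P` of a matrix `σ` on the composite system `P ⊗ G`. -/
def reduceLeft {P G : Type*} [Fintype G] (σ : Matrix (P × G) (P × G) ℂ) : Matrix P P ℂ :=
  Matrix.of fun i j => ∑ k, σ (i, k) (j, k)

open Matrix in
/-- An `(n, ε)` purity concentration code for `ρ`: a unitary from `n` copies of the system onto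
a composite of a system `A_p` of dimension `dp` and a system `A_g` of dimension `dg`, such that the
reduced output on `A_p` is `ε`-close in trace norm to the standard pure state `|0⟩⟨0|`.
No ancillas are available: unitarity forces `dp * dg = d_A ^ n`. -/
structure Code {A : Type*} [Fintype A] [DecidableEq A] (ρ : Matrix A A ℂ) (n : ℕ) (ε : ℝ) where
  /-- dimension of `A_p` -/
  dp : ℕ
  /-- dimension of `A_g` -/
  dg : ℕ
  dp_pos : 0 < dp
  /-- the unitary, as a matrix with respect to the standard product bases -/
  U : Matrix (Fin dp × Fin dg) (Fin n → A) ℂ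
  conjTranspose_mul_self : Uᴴ * U = 1
  mul_conjTranspose_self : U * Uᴴ = 1
  close : traceNorm (reduceLeft (U * tensorPow ρ n * Uᴴ)
    - Matrix.single (⟨0, dp_pos⟩ : Fin dp) ⟨0, dp_pos⟩ 1) ≤ ε

/-- The rate `(1/n) log d_{A_p}` of a code. -/
def Code.rate {A : Type*} [Fintype A] [DecidableEq A] {ρ : Matrix A A ℂ} {n : ℕ} {ε : ℝ}
    (c : Code ρ n ε) : ℝ :=
  (1 / (n : ℝ)) * Real.logb 2 c.dp

/-- `R` is achievable if for all `ε, δ > 0` and all sufficiently large `n` there is an `(n, ε)`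
code of rate at least `R - δ`. -/
def IsAchievable {A : Type*} [Fintype A] [DecidableEq A] (ρ : Matrix A A ℂ) (R : ℝ) : Prop :=
  ∀ ε > 0, ∀ δ > 0, ∃ N : ℕ, ∀ n ≥ N, ∃ c : Code ρ n ε, R - δ ≤ c.rate

/-- The purity `κ(ρ)`: the supremum of all achievable rates. -/
def purity {A : Type*} [Fintype A] [DecidableEq A] (ρ : Matrix A A ℂ) : ℝ :=
  sSup {R : ℝ | IsAchievable ρ R}

end Purity

end

/-!
In an eigenbasis, the state `ρ` is a probability distribution `p` on the index set of the basis,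
`H(ρ)` is the Shannon entropy of `p`, and `ρ^{⊗ n}` is the law of `n` independent letters drawn
from `p` (`tensorPow_rotatedDiagonal`). The weak law of large numbers, obtained from the variance
of a sum of independent variables, says that the probability of a random word is about
`2 ^ (-n H)`, and both halves of the theorem reduce to this.

*Achievability.* About `2 ^ (n H)` words carry almost all of the probability (`exists_typicalSet`).
If `d_{A_g} = d_A ^ (n - m)` is at least that number, a permutation of the eigenbasis moves all of
these words into `|0⟩ ⊗ A_g`. The output is then a classical distribution on the basis of `A_p`,
almost concentrated at `0` (`exists_code_of_finset`). Dimensions that are powers of `d_A` respect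
the constraint `d_{A_p} d_{A_g} = d_A ^ n` and lose only `(log d_A) / n` of rate by rounding.

*Converse.* If the output on `A_p` is within `1/2` of `|0⟩⟨0|` in trace norm, the projection onto
`|0⟩ ⊗ A_g`, of rank `d_{A_g}`, accepts the output with probability at least `1/2`
(`norm_diag_le_traceNorm`). Its diagonal in the eigenbasis of `ρ^{⊗ n}` is a `[0, 1]`-valued test
of total weight `d_{A_g}` (`Code.exists_test`), and such a test must have weight at least about
`2 ^ (n H)` (`exists_forall_weight_ge`). Hence `d_{A_p} = d_A ^ n / d_{A_g}` is at most about
`2 ^ (n (log d_A - H))`.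
-/

namespace Purity

open Matrix

/-! ### Functional calculus of diagonalized matrices -/

/-- The real diagonal matrices in the orthonormal basis formed by the columns of `V`, as a
star-algebra homomorphism `r ↦ V diag(r) V†`. -/
noncomputable def rotatedDiagonal {ι : Type*} [Fintype ι] [DecidableEq ι]
    (V : unitary (Matrix ι ι ℂ)) : (ι → ℝ) →⋆ₐ[ℝ] Matrix ι ι ℂ where
  toFun r := (V : Matrix ι ι ℂ) * diagonal (fun i => (r i : ℂ)) * (V : Matrix ι ι ℂ)ᴴ
  map_one' := by
    simp [← star_eq_conjTranspose]
  map_zero' := by simp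
  map_mul' r s := by
    have hV : (V : Matrix ι ι ℂ)ᴴ * V = 1 := Unitary.coe_star_mul_self V
    have : diagonal (fun i => ((r * s) i : ℂ))
        = diagonal (fun i => (r i : ℂ)) * ((V : Matrix ι ι ℂ)ᴴ * V) *
          diagonal (fun i => (s i : ℂ)) := by
      rw [hV, mul_one, diagonal_mul_diagonal]; simp
    rw [this]; simp only [mul_assoc]
  map_add' r s := by
    rw [← add_mul, ← mul_add, diagonal_add]; simp
  commutes' c := by
    have : diagonal (fun i : ι => ((algebraMap ℝ (ι → ℝ) c i : ℝ) : ℂ))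
        = c • (1 : Matrix ι ι ℂ) := by
      ext i j; by_cases h : i = j <;> simp [h]
    rw [this, Algebra.algebraMap_eq_smul_one]
    simp [← star_eq_conjTranspose]
  map_star' r := by
    simp only [star_eq_conjTranspose, conjTranspose_mul, diagonal_conjTranspose, mul_assoc,
      conjTranspose_conjTranspose]
    congr 3
    ext i; simp

theorem rotatedDiagonal_apply {ι : Type*} [Fintype ι] [DecidableEq ι]
    (V : unitary (Matrix ι ι ℂ)) (r : ι → ℝ) :
    rotatedDiagonal V r
      = (V : Matrix ι ι ℂ) * diagonal (fun i => (r i : ℂ)) * (V : Matrix ι ι ℂ)ᴴ := rfl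

theorem cfc_rotatedDiagonal {ι : Type*} [Fintype ι] [DecidableEq ι]
    (V : unitary (Matrix ι ι ℂ)) (f : ℝ → ℝ) (r : ι → ℝ) :
    cfc f (rotatedDiagonal V r) = rotatedDiagonal V (fun i => f (r i)) := by
  have hs : IsSelfAdjoint (rotatedDiagonal V r) :=
    (show IsSelfAdjoint r by ext; simp).map (rotatedDiagonal V)
  -- On the finite set of eigenvalues, `f` coincides with an interpolating polynomial `q`.
  let q := Lagrange.interpolate (Finset.univ.image r) id f
  have hq : ∀ i, q.eval (r i) = f (r i) := fun i =>
    Lagrange.eval_interpolate_at_node (v := id) f (Function.injective_id.injOn)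
      (Finset.mem_image_of_mem r (Finset.mem_univ i))
  have hspec : (spectrum ℝ (rotatedDiagonal V r)).EqOn f q.eval := by
    intro x hx
    have hx' := AlgHom.spectrum_apply_subset (rotatedDiagonal V) r hx
    rw [Pi.spectrum_eq, Set.mem_iUnion] at hx'
    obtain ⟨i, hi⟩ := hx'
    have hi' : x ∈ spectrum ℝ (algebraMap ℝ ℝ (r i)) := hi
    rw [spectrum.scalar_eq, Set.mem_singleton_iff] at hi'
    rw [hi']
    exact (hq i).symm
  rw [cfc_congr hspec, cfc_polynomial q _ hs,
    show rotatedDiagonal V r = (rotatedDiagonal V).toAlgHom r from rfl,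
    Polynomial.aeval_algHom_apply]
  refine congrArg (rotatedDiagonal V) (funext fun i => ?_)
  rw [← hq i, ← Pi.evalAlgHom_apply ℝ (fun _ : ι => ℝ) i (Polynomial.aeval r q),
    ← Polynomial.aeval_algHom_apply]
  simp [Polynomial.coe_aeval_eq_eval]

theorem trace_rotatedDiagonal {ι : Type*} [Fintype ι] [DecidableEq ι]
    (V : unitary (Matrix ι ι ℂ)) (r : ι → ℝ) :
    (rotatedDiagonal V r).trace = ((∑ i, r i : ℝ) : ℂ) := by
  have hV : (V : Matrix ι ι ℂ)ᴴ * V = 1 := Unitary.coe_star_mul_self V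
  rw [rotatedDiagonal_apply, trace_mul_comm, ← mul_assoc, hV, one_mul, trace_diagonal]
  simp

theorem exists_rotatedDiagonal {ι : Type*} [Fintype ι] [DecidableEq ι] {M : Matrix ι ι ℂ}
    (hM : M.IsHermitian) : ∃ V r, M = rotatedDiagonal V r :=
  ⟨hM.eigenvectorUnitary, hM.eigenvalues, hM.spectral_theorem⟩

theorem entropy_rotatedDiagonal {ι : Type*} [Fintype ι] [DecidableEq ι]
    (V : unitary (Matrix ι ι ℂ)) (p : ι → ℝ) :
    entropy (rotatedDiagonal V p) = -∑ i, p i * Real.logb 2 (p i) := by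
  rw [entropy, cfc_rotatedDiagonal, ← map_mul, trace_rotatedDiagonal, Complex.ofReal_re]
  rfl

theorem traceNorm_rotatedDiagonal {ι : Type*} [Fintype ι] [DecidableEq ι]
    (V : unitary (Matrix ι ι ℂ)) (r : ι → ℝ) :
    traceNorm (rotatedDiagonal V r) = ∑ i, |r i| := by
  rw [traceNorm, ← star_eq_conjTranspose, ← map_star, ← map_mul, cfc_rotatedDiagonal,
    trace_rotatedDiagonal, Complex.ofReal_re]
  simp [Real.sqrt_mul_self_eq_abs]

theorem traceNorm_diagonal {ι : Type*} [Fintype ι] [DecidableEq ι] (r : ι → ℝ) :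
    traceNorm (diagonal fun i => (r i : ℂ)) = ∑ i, |r i| := by
  rw [← traceNorm_rotatedDiagonal 1 r, rotatedDiagonal_apply]
  simp

/-- The rows of a unitary are normalized. -/
theorem sum_normSq_row {ι κ : Type*} [Fintype ι] [DecidableEq κ]
    {B : Matrix κ ι ℂ} (hB : B * Bᴴ = 1) (z : κ) : ∑ x, Complex.normSq (B z x) = 1 := by
  have := congrFun (congrFun hB z) z
  rw [mul_apply, one_apply_eq] at this
  apply Complex.ofReal_injective
  push_cast
  rw [← this]
  exact Finset.sum_congr rfl fun x _ => (Complex.mul_conj _).symm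

/-- The columns of a unitary are normalized. -/
theorem sum_normSq_column {ι κ : Type*} [Fintype κ] [DecidableEq ι]
    {B : Matrix κ ι ℂ} (hB : Bᴴ * B = 1) (x : ι) : ∑ z, Complex.normSq (B z x) = 1 := by
  simpa using sum_normSq_row (B := Bᴴ) (by rwa [conjTranspose_conjTranspose]) x

theorem conj_diagonal_apply {ι κ : Type*} [Fintype ι] [DecidableEq ι]
    (B : Matrix κ ι ℂ) (r : ι → ℝ) (z : κ) :
    (B * diagonal (fun i => (r i : ℂ)) * Bᴴ) z z
      = ((∑ x, Complex.normSq (B z x) * r x : ℝ) : ℂ) := by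
  rw [mul_apply]
  push_cast
  refine Finset.sum_congr rfl fun x _ => ?_
  rw [mul_diagonal, conjTranspose_apply, mul_right_comm, Complex.star_def, Complex.mul_conj]

/-- The trace norm of a Hermitian matrix bounds its diagonal entries, which are averages of its
eigenvalues. -/
theorem norm_diag_le_traceNorm {ι : Type*} [Fintype ι] [DecidableEq ι] {M : Matrix ι ι ℂ}
    (hM : M.IsHermitian) (i : ι) : |(M i i).re| ≤ traceNorm M := by
  obtain ⟨V, r, rfl⟩ := exists_rotatedDiagonal hM
  rw [traceNorm_rotatedDiagonal, rotatedDiagonal_apply, conj_diagonal_apply, Complex.ofReal_re]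
  refine (Finset.abs_sum_le_sum_abs _ _).trans (Finset.sum_le_sum fun x _ => ?_)
  rw [abs_mul, abs_of_nonneg (Complex.normSq_nonneg _)]
  refine mul_le_of_le_one_left (abs_nonneg _) ?_
  rw [← sum_normSq_row (Unitary.coe_mul_star_self V) i]
  exact Finset.single_le_sum (f := fun x => Complex.normSq ((V : Matrix ι ι ℂ) i x))
    (fun _ _ => Complex.normSq_nonneg _) (Finset.mem_univ x)

/-! ### Tensor powers -/

theorem tensorPow_mul {A : Type*} [Fintype A] [DecidableEq A] (M N : Matrix A A ℂ) (n : ℕ) :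
    tensorPow (M * N) n = tensorPow M n * tensorPow N n := by
  ext x y
  simp only [tensorPow, of_apply, mul_apply, ← Finset.prod_mul_distrib]
  rw [Finset.prod_univ_sum, Fintype.piFinset_univ]

theorem tensorPow_diagonal {A : Type*} [DecidableEq A] (d : A → ℂ) (n : ℕ) :
    tensorPow (diagonal d) n = diagonal fun x => ∏ k, d (x k) := by
  ext x y
  by_cases h : x = y
  · simp [tensorPow, h]
  · obtain ⟨k, hk⟩ := Function.ne_iff.mp h
    rw [diagonal_apply_ne _ h, tensorPow, of_apply]
    exact Finset.prod_eq_zero (Finset.mem_univ k) (diagonal_apply_ne _ hk)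

theorem tensorPow_one {A : Type*} [DecidableEq A] (n : ℕ) :
    tensorPow (1 : Matrix A A ℂ) n = 1 := by
  rw [← diagonal_one, tensorPow_diagonal]
  simp

theorem tensorPow_conjTranspose {A : Type*} (M : Matrix A A ℂ) (n : ℕ) :
    tensorPow Mᴴ n = (tensorPow M n)ᴴ := by
  ext x y
  simp [tensorPow]

/-- The tensor power of a unitary, as a unitary. -/
def tensorPowUnitary {A : Type*} [Fintype A] [DecidableEq A] (V : unitary (Matrix A A ℂ))
    (n : ℕ) : unitary (Matrix (Fin n → A) (Fin n → A) ℂ) :=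
  ⟨tensorPow V n, by
    rw [Unitary.mem_iff, star_eq_conjTranspose, ← tensorPow_conjTranspose, ← tensorPow_mul,
      ← tensorPow_mul, ← star_eq_conjTranspose, Unitary.star_mul_self_of_mem V.2,
      Unitary.mul_star_self_of_mem V.2, tensorPow_one]
    exact ⟨rfl, rfl⟩⟩

/-- The eigenvalues of `ρ^{⊗ n}` are the probabilities of the `n`-letter words of an i.i.d. source
whose letters are distributed according to the eigenvalues of `ρ`. -/
theorem tensorPow_rotatedDiagonal {A : Type*} [Fintype A] [DecidableEq A]
    (V : unitary (Matrix A A ℂ)) (p : A → ℝ) (n : ℕ) :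
    tensorPow (rotatedDiagonal V p) n
      = rotatedDiagonal (tensorPowUnitary V n) (fun x => ∏ k, p (x k)) := by
  rw [rotatedDiagonal_apply, rotatedDiagonal_apply, tensorPow_mul, tensorPow_mul,
    tensorPow_diagonal, tensorPow_conjTranspose]
  simp [tensorPowUnitary]

/-! ### Typical sequences -/

theorem sum_prod_eq_one {A : Type*} [Fintype A] {p : A → ℝ} (hp : ∑ a, p a = 1) (n : ℕ) :
    ∑ x : Fin n → A, ∏ k, p (x k) = 1 := by
  classical
  have := Finset.prod_univ_sum (fun _ : Fin n => (Finset.univ : Finset A)) (fun _ a => p a)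
  rw [Fintype.piFinset_univ] at this
  rw [← this]
  simp [hp]

/-- The variance of a sum of `n` independent copies of a centred random variable `g` is `n` times
the variance of `g`. -/
theorem sum_prod_mul_sum_sq {A : Type*} [Fintype A] {p : A → ℝ} (hp : ∑ a, p a = 1)
    {g : A → ℝ} (hg : ∑ a, p a * g a = 0) (n : ℕ) :
    ∑ x : Fin n → A, (∏ k, p (x k)) * (∑ k, g (x k)) ^ 2 = n * ∑ a, p a * g a ^ 2 := by
  induction n with
  | zero => simp
  | succ n ih =>
    rw [← (Fin.consEquiv fun _ : Fin (n + 1) => A).sum_comp, Fintype.sum_prod_type]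
    simp only [Fin.consEquiv_apply, Fin.prod_univ_succ, Fin.sum_univ_succ, Fin.cons_zero,
      Fin.cons_succ]
    -- The cross term of the square carries the factor `∑ a, p a * g a = 0`.
    have key : ∀ a, ∑ x : Fin n → A, p a * (∏ k, p (x k)) * (g a + ∑ k, g (x k)) ^ 2
        = p a * g a ^ 2 + p a * g a * (2 * ∑ x : Fin n → A, (∏ k, p (x k)) * ∑ k, g (x k))
          + p a * (n * ∑ a, p a * g a ^ 2) := by
      intro a
      rw [← ih, ← mul_one (p a * g a ^ 2), ← sum_prod_eq_one hp n, Finset.mul_sum, Finset.mul_sum,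
        Finset.mul_sum, Finset.mul_sum, ← Finset.sum_add_distrib, ← Finset.sum_add_distrib]
      exact Finset.sum_congr rfl fun x _ => by ring
    simp only [key, Finset.sum_add_distrib, ← Finset.sum_mul, hg, hp]
    push_cast; ring

/-- Weak law of large numbers for a source with finite alphabet. -/
theorem eventually_sum_deviation_le {A : Type*} [Fintype A] {p : A → ℝ} (hp0 : ∀ a, 0 ≤ p a)
    (hp : ∑ a, p a = 1) (f : A → ℝ) {δ η : ℝ} (hδ : 0 < δ) (hη : 0 < η) :
    ∃ N : ℕ, ∀ n ≥ N,
      ∑ x : Fin n → A with n * δ < |∑ k, f (x k) - n * ∑ a, p a * f a|, ∏ k, p (x k) ≤ η := by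
  set m := ∑ a, p a * f a with hm
  set v := ∑ a, p a * (f a - m) ^ 2
  obtain ⟨N, hN⟩ := exists_nat_gt (v / (δ ^ 2 * η))
  refine ⟨N + 1, fun n hn => ?_⟩
  have hn0 : (0 : ℝ) < n := by exact_mod_cast (by omega : 0 < n)
  have hg : ∑ a, p a * (f a - m) = 0 := by
    simp only [mul_sub, Finset.sum_sub_distrib, ← Finset.sum_mul, hp, ← hm]; ring
  have hvar := sum_prod_mul_sum_sq hp hg n
  have hP : ∀ x : Fin n → A, 0 ≤ ∏ k, p (x k) := fun x => Finset.prod_nonneg fun k _ => hp0 _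
  have hcheb : (n * δ) ^ 2 *
      ∑ x : Fin n → A with n * δ < |∑ k, f (x k) - n * m|, ∏ k, p (x k) ≤ n * v := by
    rw [← hvar, Finset.mul_sum]
    refine (Finset.sum_le_sum fun x hx => ?_).trans (Finset.sum_le_sum_of_subset_of_nonneg
      (Finset.filter_subset _ _) fun x _ _ => mul_nonneg (hP x) (sq_nonneg _))
    rw [mul_comm]
    refine mul_le_mul_of_nonneg_left ?_ (hP x)
    have h := (Finset.mem_filter.mp hx).2
    have : ∑ k, (f (x k) - m) = ∑ k, f (x k) - n * m := by simp
    rw [this, ← sq_abs (_ - _)]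
    exact pow_le_pow_left₀ (by positivity) h.le 2
  have hv : v ≤ n * (δ ^ 2 * η) := by
    have h1 : v / (δ ^ 2 * η) ≤ n := hN.le.trans (by exact_mod_cast (by omega : N ≤ n))
    rwa [div_le_iff₀ (by positivity)] at h1
  have h2 : (n * δ) ^ 2 *
      ∑ x : Fin n → A with n * δ < |∑ k, f (x k) - n * m|, ∏ k, p (x k) ≤ (n * δ) ^ 2 * η :=
    hcheb.trans (by nlinarith [mul_le_mul_of_nonneg_left hv hn0.le])
  exact le_of_mul_le_mul_left h2 (by positivity)

theorem prod_eq_rpow_sum_logb {A : Type*} {p : A → ℝ} (hp0 : ∀ a, 0 ≤ p a) {n : ℕ}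
    {x : Fin n → A} (hx : ∏ k, p (x k) ≠ 0) :
    ∏ k, p (x k) = (2 : ℝ) ^ (-∑ k, -Real.logb 2 (p (x k))) := by
  rw [Finset.sum_neg_distrib, neg_neg, Real.rpow_sum_of_pos two_pos]
  refine Finset.prod_congr rfl fun k hk => ?_
  exact (Real.rpow_logb two_pos (by norm_num)
    ((hp0 _).lt_of_ne (Finset.prod_ne_zero_iff.mp hx k hk).symm)).symm

/-- Source coding: almost all of the probability is carried by `2 ^ (n (H + δ))` words. -/
theorem exists_typicalSet {A : Type*} [Fintype A] {p : A → ℝ} (hp0 : ∀ a, 0 ≤ p a)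
    (hp : ∑ a, p a = 1) {δ η : ℝ} (hδ : 0 < δ) (hη : 0 < η) :
    ∃ N : ℕ, ∀ n ≥ N, ∃ T : Finset (Fin n → A), 1 - η ≤ ∑ x ∈ T, ∏ k, p (x k) ∧
      (T.card : ℝ) ≤ 2 ^ (n * (-∑ a, p a * Real.logb 2 (p a) + δ)) := by
  classical
  obtain ⟨N, hN⟩ := eventually_sum_deviation_le hp0 hp (fun a => -Real.logb 2 (p a)) hδ hη
  refine ⟨N, fun n hn => ?_⟩
  have htail := hN n hn
  simp only [mul_neg, Finset.sum_neg_distrib (f := fun a => p a * Real.logb 2 (p a))] at htail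
  set H := -∑ a, p a * Real.logb 2 (p a)
  set P : (Fin n → A) → ℝ := fun x => ∏ k, p (x k) with hPdef
  have hP : ∀ x, 0 ≤ P x := fun x => Finset.prod_nonneg fun k _ => hp0 _
  set B : Finset (Fin n → A) :=
    Finset.univ.filter fun x => n * δ < |∑ k, -Real.logb 2 (p (x k)) - n * H| with hB
  have htail : ∑ x ∈ B, P x ≤ η := by simpa [hB, hPdef, H] using htail
  refine ⟨Bᶜ.filter fun x => P x ≠ 0, ?_, ?_⟩
  · rw [Finset.sum_filter_ne_zero]
    have := Finset.sum_add_sum_compl B P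
    rw [sum_prod_eq_one hp n] at this
    linarith
  · set T := Bᶜ.filter fun x => P x ≠ 0
    have h1 : ∀ x ∈ T, (2 : ℝ) ^ (-(n * (H + δ))) ≤ P x := by
      intro x hx
      obtain ⟨hxB, hx0⟩ := Finset.mem_filter.mp hx
      simp only [hB, Finset.mem_compl, Finset.mem_filter, Finset.mem_univ, true_and, not_lt] at hxB
      rw [hPdef]; beta_reduce
      rw [prod_eq_rpow_sum_logb hp0 hx0]
      refine Real.rpow_le_rpow_of_exponent_le one_le_two ?_
      have := (abs_le.mp hxB).2
      linarith
    have h2 : T.card * (2 : ℝ) ^ (-(n * (H + δ))) ≤ 1 := by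
      rw [← nsmul_eq_mul, ← sum_prod_eq_one hp n]
      exact (Finset.card_nsmul_le_sum T P _ h1).trans
        (Finset.sum_le_univ_sum_of_nonneg hP)
    rwa [Real.rpow_neg zero_le_two, ← div_eq_mul_inv, div_le_one (by positivity)] at h2

/-- Converse of source coding, for randomized tests: a test `w` which accepts a word with
probability at least `1/2` has total weight at least about `2 ^ (n H)`. -/
theorem exists_forall_weight_ge {A : Type*} [Fintype A] {p : A → ℝ} (hp0 : ∀ a, 0 ≤ p a)
    (hp : ∑ a, p a = 1) {δ : ℝ} (hδ : 0 < δ) :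
    ∃ N : ℕ, ∀ n ≥ N, ∀ w : (Fin n → A) → ℝ, (∀ x, 0 ≤ w x) → (∀ x, w x ≤ 1) →
      1 / 2 ≤ ∑ x, w x * ∏ k, p (x k) →
      (2 : ℝ) ^ (n * (-∑ a, p a * Real.logb 2 (p a) - δ) - 2) ≤ ∑ x, w x := by
  classical
  obtain ⟨N, hN⟩ := eventually_sum_deviation_le hp0 hp (fun a => -Real.logb 2 (p a)) hδ
    (show (0 : ℝ) < 1 / 4 by norm_num)
  refine ⟨N, fun n hn w hw0 hw1 hw => ?_⟩
  have htail := hN n hn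
  set H := -∑ a, p a * Real.logb 2 (p a)
  set P : (Fin n → A) → ℝ := fun x => ∏ k, p (x k) with hPdef
  have hP : ∀ x, 0 ≤ P x := fun x => Finset.prod_nonneg fun k _ => hp0 _
  set B : Finset (Fin n → A) :=
    Finset.univ.filter fun x => n * δ < |∑ k, -Real.logb 2 (p (x k)) - n * H| with hB
  have htail : ∑ x ∈ B, P x ≤ 1 / 4 := by simpa [hB, hPdef, H] using htail
  have h1 : ∑ x ∈ B, w x * P x ≤ 1 / 4 :=
    (Finset.sum_le_sum fun x _ => mul_le_of_le_one_left (hP x) (hw1 x)).trans htail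
  have h2 : ∑ x ∈ Bᶜ, w x * P x ≤ (∑ x, w x) * (2 : ℝ) ^ (-(n * (H - δ))) := by
    rw [Finset.sum_mul]
    refine (Finset.sum_le_sum fun x hx => ?_).trans (Finset.sum_le_univ_sum_of_nonneg
      fun x => mul_nonneg (hw0 x) (by positivity))
    refine mul_le_mul_of_nonneg_left ?_ (hw0 x)
    by_cases hx0 : P x = 0
    · rw [hx0]; positivity
    simp only [hB, Finset.mem_compl, Finset.mem_filter, Finset.mem_univ, true_and, not_lt] at hx
    rw [hPdef]; beta_reduce
    rw [prod_eq_rpow_sum_logb hp0 hx0]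
    refine Real.rpow_le_rpow_of_exponent_le one_le_two ?_
    have := (abs_le.mp hx).1
    linarith
  have h3 := Finset.sum_add_sum_compl B fun x => w x * P x
  have h4 : 1 / 4 ≤ (∑ x, w x) * (2 : ℝ) ^ (-(n * (H - δ))) := by linarith
  rw [Real.rpow_neg zero_le_two, ← div_eq_mul_inv, le_div_iff₀ (by positivity)] at h4
  rw [Real.rpow_sub two_pos]
  norm_num
  linarith

/-! ### Codes -/

open scoped ComplexOrder in
/-- In an eigenbasis, a state is a probability distribution. -/
theorem IsState.exists_eq_rotatedDiagonal {A : Type*} [Fintype A] [DecidableEq A]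
    {ρ : Matrix A A ℂ} (hρ : IsState ρ) :
    ∃ (V : unitary (Matrix A A ℂ)) (p : A → ℝ),
      (∀ a, 0 ≤ p a) ∧ ∑ a, p a = 1 ∧ ρ = rotatedDiagonal V p := by
  have h : ρ = rotatedDiagonal hρ.posSemidef.isHermitian.eigenvectorUnitary
      hρ.posSemidef.isHermitian.eigenvalues := hρ.posSemidef.isHermitian.spectral_theorem
  refine ⟨_, _, hρ.posSemidef.eigenvalues_nonneg, ?_, h⟩
  have ht := (congrArg trace h).symm.trans hρ.trace_eq_one
  rw [trace_rotatedDiagonal] at ht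
  exact_mod_cast ht

theorem Code.dp_mul_dg {A : Type*} [Fintype A] [DecidableEq A] {ρ : Matrix A A ℂ} {n : ℕ} {ε : ℝ}
    (c : Code ρ n ε) : c.dp * c.dg = Fintype.card A ^ n := by
  have h := trace_mul_comm c.U c.Uᴴ
  rw [c.conjTranspose_mul_self, c.mul_conjTranspose_self, trace_one, trace_one] at h
  have h' : Fintype.card (Fin c.dp × Fin c.dg) = Fintype.card (Fin n → A) := by exact_mod_cast h
  simpa using h'

theorem reduceLeft_isHermitian {P G : Type*} [Fintype G] {σ : Matrix (P × G) (P × G) ℂ}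
    (hσ : σ.IsHermitian) : (reduceLeft σ).IsHermitian := by
  ext i j
  simp only [reduceLeft, conjTranspose_apply, of_apply, star_sum]
  exact Finset.sum_congr rfl fun k _ => hσ.apply _ _

/-- A finset of words, of cardinality at most `dg`, can be moved by a bijection into the block
`{i₀} × Fin dg` of a product of the right size. -/
theorem exists_equiv_maps_to_block {X : Type*} [Fintype X] {dp dg : ℕ}
    (hcard : Fintype.card X = dp * dg) (i₀ : Fin dp) (T : Finset X) (hT : T.card ≤ dg) :
    ∃ e : X ≃ Fin dp × Fin dg, ∀ x ∈ T, (e x).1 = i₀ := by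
  classical
  obtain ⟨ι⟩ : Nonempty (T ↪ Fin dg) := Function.Embedding.nonempty_of_card_le (by simpa using hT)
  obtain ⟨e₀⟩ : Nonempty (X ≃ Fin dp × Fin dg) := by
    rw [← Fintype.card_eq]; simpa using hcard
  let f : X → Fin dp × Fin dg := fun x => if h : x ∈ T then (i₀, ι ⟨x, h⟩) else e₀ x
  have hf : ∀ x (h : x ∈ T), f x = (i₀, ι ⟨x, h⟩) := fun x h => dif_pos h
  obtain ⟨g, hg⟩ := Finset.exists_equiv_extend_of_card_eq (t := Finset.univ) (s := T) (f := f)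
    (by simpa using hcard) (Finset.subset_univ _) (by
      intro x hx y hy hxy
      rw [hf x hx, hf y hy, Prod.mk.injEq] at hxy
      exact congrArg Subtype.val (ι.injective hxy.2))
  refine ⟨g.trans (Equiv.subtypeUnivEquiv Finset.mem_univ), fun x hx => ?_⟩
  have := hg x hx
  rw [hf x hx] at this
  exact congrArg Prod.fst this

/-- Rotating into the eigenbasis of `ρ^{⊗ n}` and then permuting the basis vectors, so that those
indexed by `T` end up in `|0⟩ ⊗ A_g`, gives a code whose error is governed by the probability
of `T`. -/
theorem exists_code_of_finset {A : Type*} [Fintype A] [DecidableEq A]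
    (V : unitary (Matrix A A ℂ)) {p : A → ℝ} (hp0 : ∀ a, 0 ≤ p a) (hp : ∑ a, p a = 1)
    {n dp dg : ℕ} {ε : ℝ} (hdp : 0 < dp) (hcard : Fintype.card A ^ n = dp * dg)
    (T : Finset (Fin n → A)) (hT : T.card ≤ dg) (hprob : 1 - ε / 2 ≤ ∑ x ∈ T, ∏ k, p (x k)) :
    ∃ c : Code (rotatedDiagonal V p) n ε, c.dp = dp := by
  classical
  obtain ⟨e, he⟩ := exists_equiv_maps_to_block (X := Fin n → A) (by simpa using hcard)
    ⟨0, hdp⟩ T hT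
  obtain ⟨W, hW⟩ : ∃ W : Matrix (Fin n → A) (Fin n → A) ℂ, W = tensorPowUnitary V n := ⟨_, rfl⟩
  set P : (Fin n → A) → ℝ := fun x => ∏ k, p (x k) with hPdef
  have hP : ∀ x, 0 ≤ P x := fun x => Finset.prod_nonneg fun k _ => hp0 _
  have hWW : Wᴴ * W = 1 := by rw [hW]; exact Unitary.coe_star_mul_self _
  have hWW' : W * Wᴴ = 1 := by rw [hW]; exact Unitary.coe_mul_star_self _
  let U : Matrix (Fin dp × Fin dg) (Fin n → A) ℂ :=
    Wᴴ.submatrix e.symm id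
  have hU : Uᴴ = W.submatrix id e.symm := by
    rw [conjTranspose_submatrix, conjTranspose_conjTranspose]
  have h1 : Uᴴ * U = 1 := by
    rw [hU, submatrix_mul_equiv, hWW', submatrix_id_id]
  have h2 : U * Uᴴ = 1 := by
    rw [hU]
    rw [← submatrix_mul _ _ _ _ _ Function.bijective_id, hWW, submatrix_one_equiv]
  have hσ : U * tensorPow (rotatedDiagonal V p) n * Uᴴ
      = diagonal fun z => ((P (e.symm z) : ℝ) : ℂ) := by
    rw [tensorPow_rotatedDiagonal, rotatedDiagonal_apply, ← hW]
    have : Wᴴ *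
        (W * diagonal (fun i => ((P i : ℝ) : ℂ)) * Wᴴ) * W
        = diagonal (fun i => ((P i : ℝ) : ℂ)) := by
      rw [mul_assoc, mul_assoc, hWW, mul_one, ← mul_assoc, hWW, one_mul]
    have h3 := congrArg (fun M => M.submatrix e.symm e.symm) this
    rw [submatrix_diagonal_equiv] at h3
    rw [hU]
    refine Eq.trans ?_ h3
    rw [submatrix_mul _ _ _ _ _ Function.bijective_id,
      submatrix_mul _ _ _ _ _ Function.bijective_id, submatrix_id_id]
  -- `q` is the distribution of the output on `A_p`.
  let q : Fin dp → ℝ := fun i => ∑ k, P (e.symm (i, k))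
  have hq0 : ∀ i, 0 ≤ q i := fun i => Finset.sum_nonneg fun k _ => hP _
  have hqs : ∑ i, q i = 1 := by
    rw [← sum_prod_eq_one hp n, ← e.symm.sum_comp, Fintype.sum_prod_type]
  have hqT : 1 - ε / 2 ≤ q ⟨0, hdp⟩ := by
    refine hprob.trans ?_
    have : ∑ x ∈ T, P x ≤ ∑ x with (e x).1 = ⟨0, hdp⟩, P x :=
      Finset.sum_le_sum_of_subset_of_nonneg (fun x hx => by simp [he x hx]) fun x _ _ => hP x
    refine this.trans (le_of_eq ?_)
    rw [Finset.sum_filter, ← e.symm.sum_comp, Fintype.sum_prod_type]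
    simp only [Equiv.apply_symm_apply]
    rw [Finset.sum_eq_single ⟨0, hdp⟩ (fun b _ hb => by simp [hb]) (by simp)]
    simp [q]
  have hred : reduceLeft (U * tensorPow (rotatedDiagonal V p) n * Uᴴ)
      - Matrix.single (⟨0, hdp⟩ : Fin dp) ⟨0, hdp⟩ 1
      = diagonal fun i => ((q i - if i = ⟨0, hdp⟩ then 1 else 0 : ℝ) : ℂ) := by
    rw [hσ]
    ext i j
    by_cases hij : i = j
    · subst hij
      simp only [Matrix.sub_apply, reduceLeft, of_apply, diagonal_apply_eq, q, single_apply,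
        and_self]
      by_cases hi : i = ⟨0, hdp⟩ <;> simp [hi, eq_comm]
    · rw [diagonal_apply_ne _ hij, Matrix.sub_apply, reduceLeft, of_apply, single_apply]
      rw [Finset.sum_eq_zero fun k _ => diagonal_apply_ne _ (by simp [hij]),
        if_neg (by rintro ⟨rfl, rfl⟩; exact hij rfl), sub_zero]
  refine ⟨⟨dp, dg, hdp, U, h1, h2, ?_⟩, rfl⟩
  rw [hred, traceNorm_diagonal, ← Finset.add_sum_erase _ _ (Finset.mem_univ (⟨0, hdp⟩ : Fin dp))]
  rw [← Finset.add_sum_erase _ _ (Finset.mem_univ (⟨0, hdp⟩ : Fin dp))] at hqs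
  have hrest : ∑ i ∈ Finset.univ.erase (⟨0, hdp⟩ : Fin dp),
      |q i - if i = ⟨0, hdp⟩ then 1 else 0| = ∑ i ∈ Finset.univ.erase (⟨0, hdp⟩ : Fin dp), q i :=
    Finset.sum_congr rfl fun i hi => by
      rw [if_neg (Finset.ne_of_mem_erase hi), sub_zero, abs_of_nonneg (hq0 i)]
  have hrest0 : 0 ≤ ∑ i ∈ Finset.univ.erase (⟨0, hdp⟩ : Fin dp), q i :=
    Finset.sum_nonneg fun i _ => hq0 i
  rw [hrest, if_pos rfl, abs_of_nonpos (by linarith)]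
  linarith

/-- A code of error at most `1/2` provides a test `w` of total weight `dg` which accepts the
eigenvectors of `ρ^{⊗ n}`, drawn with their probabilities, with probability at least `1/2`:
measure whether `A_p` is in the state `|0⟩`. -/
theorem Code.exists_test {A : Type*} [Fintype A] [DecidableEq A]
    {V : unitary (Matrix A A ℂ)} {p : A → ℝ} {n : ℕ} (c : Code (rotatedDiagonal V p) n (1 / 2)) :
    ∃ w : (Fin n → A) → ℝ, (∀ x, 0 ≤ w x) ∧ (∀ x, w x ≤ 1) ∧
      1 / 2 ≤ ∑ x, w x * ∏ k, p (x k) ∧ ∑ x, w x = c.dg := by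
  obtain ⟨W, hW⟩ : ∃ W : Matrix (Fin n → A) (Fin n → A) ℂ, W = tensorPowUnitary V n := ⟨_, rfl⟩
  have hWW : Wᴴ * W = 1 := by rw [hW]; exact Unitary.coe_star_mul_self _
  have hWW' : W * Wᴴ = 1 := by rw [hW]; exact Unitary.coe_mul_star_self _
  set B : Matrix (Fin c.dp × Fin c.dg) (Fin n → A) ℂ := c.U * W with hB
  have hBB : Bᴴ * B = 1 := by
    rw [hB, conjTranspose_mul, Matrix.mul_assoc, ← Matrix.mul_assoc c.Uᴴ,
      c.conjTranspose_mul_self, Matrix.one_mul, hWW]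
  have hBB' : B * Bᴴ = 1 := by
    rw [hB, conjTranspose_mul, Matrix.mul_assoc, ← Matrix.mul_assoc W, hWW',
      Matrix.one_mul, c.mul_conjTranspose_self]
  have hσ : c.U * tensorPow (rotatedDiagonal V p) n * c.Uᴴ
      = B * (diagonal fun x => ((∏ k, p (x k) : ℝ) : ℂ) : Matrix (Fin n → A) (Fin n → A) ℂ)
        * Bᴴ := by
    have h := tensorPow_rotatedDiagonal V p n
    rw [rotatedDiagonal_apply (tensorPowUnitary V n), ← hW] at h
    simp only [h, hB, conjTranspose_mul, Matrix.mul_assoc]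
  set i₀ : Fin c.dp := ⟨0, c.dp_pos⟩
  refine ⟨fun x => ∑ g, Complex.normSq (B (i₀, g) x),
    fun x => Finset.sum_nonneg fun g _ => Complex.normSq_nonneg _, fun x => ?_, ?_, ?_⟩
  · refine le_of_le_of_eq ?_ (sum_normSq_column hBB x)
    rw [Fintype.sum_prod_type]
    exact Finset.single_le_sum (f := fun i => ∑ g, Complex.normSq (B (i, g) x))
      (fun i _ => Finset.sum_nonneg fun g _ => Complex.normSq_nonneg _) (Finset.mem_univ i₀)
  · have hherm : (reduceLeft (c.U * tensorPow (rotatedDiagonal V p) n * c.Uᴴ)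
        - Matrix.single i₀ i₀ 1).IsHermitian := by
      refine (reduceLeft_isHermitian ?_).sub ?_
      · rw [hσ]
        refine isHermitian_mul_mul_conjTranspose B ?_
        exact isHermitian_diagonal_of_self_adjoint _ (by ext x; simp)
      · rw [IsHermitian, conjTranspose_single, star_one]
    have h := (norm_diag_le_traceNorm hherm i₀).trans c.close
    rw [hσ, Matrix.sub_apply, single_apply_same, reduceLeft, of_apply,
      Finset.sum_congr rfl fun g _ => conj_diagonal_apply B _ (i₀, g)] at h
    have h' := (abs_le.mp h).1
    rw [← Complex.ofReal_sum, Complex.sub_re, Complex.ofReal_re, Complex.one_re,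
      Finset.sum_comm] at h'
    simp only [Finset.sum_mul]
    linarith
  · rw [Finset.sum_comm]
    simp [sum_normSq_row hBB']

/-! ### The optimal rate -/

theorem isAchievable_logb_card_sub_entropy {A : Type*} [Fintype A] [DecidableEq A]
    {ρ : Matrix A A ℂ} (hρ : IsState ρ) :
    IsAchievable ρ (Real.logb 2 (Fintype.card A) - entropy ρ) := by
  intro ε hε δ hδ
  obtain ⟨V, p, hp0, hp, rfl⟩ := hρ.exists_eq_rotatedDiagonal
  have hH : 0 ≤ -∑ a, p a * Real.logb 2 (p a) := by
    rw [neg_nonneg]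
    refine Finset.sum_nonpos fun a _ => mul_nonpos_of_nonneg_of_nonpos (hp0 a) ?_
    refine Real.logb_nonpos one_lt_two (hp0 a) ?_
    rw [← hp]
    exact Finset.single_le_sum (fun a _ => hp0 a) (Finset.mem_univ a)
  obtain ⟨N, hN⟩ := exists_typicalSet hp0 hp (half_pos hδ) (half_pos hε)
  rw [entropy_rotatedDiagonal]
  set H := -∑ a, p a * Real.logb 2 (p a)
  have hd : 0 < Fintype.card A := by
    rw [Fintype.card_pos_iff]
    by_contra h
    rw [not_nonempty_iff] at h
    simp at hp
  set L := Real.logb 2 (Fintype.card A) with hL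
  have hL0 : 0 ≤ L := Real.logb_nonneg one_lt_two (by exact_mod_cast hd)
  have hpow : ∀ m : ℕ, ((Fintype.card A ^ m : ℕ) : ℝ) = 2 ^ (m * L) := by
    intro m
    rw [mul_comm, Real.rpow_mul zero_le_two, hL,
      Real.rpow_logb two_pos (by norm_num) (by exact_mod_cast hd), Real.rpow_natCast]
    push_cast; rfl
  obtain ⟨M, hM⟩ := exists_nat_gt (2 * L / δ)
  refine ⟨max N (M + 1), fun n hn => ?_⟩
  obtain ⟨T, hTprob, hTcard⟩ := hN n (le_of_max_le_left hn)
  have hnM : M + 1 ≤ n := le_of_max_le_right hn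
  have hn0 : (0 : ℝ) < n := by exact_mod_cast (by omega : 0 < n)
  -- `A_p` consists of `m` of the `n` subsystems; for `d_A = 1` the quotient has the value `0`.
  set m := ⌊n * (L - H - δ / 2) / L⌋₊ with hm
  have hmn : m ≤ n := by
    refine Nat.floor_le_of_le (div_le_of_le_mul₀ hL0 hn0.le ?_)
    exact mul_le_mul_of_nonneg_left (by linarith) hn0.le
  have hTm : T.card ≤ Fintype.card A ^ (n - m) := by
    rcases Nat.eq_zero_or_pos m with h0 | hpos
    · rw [h0, Nat.sub_zero]
      simpa using Finset.card_le_univ T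
    · have h1 : (m : ℝ) ≤ n * (L - H - δ / 2) / L := Nat.floor_le ((Nat.pos_of_floor_pos hpos).le)
      have hLpos : 0 < L := hL0.lt_of_ne fun h => by
        rw [← h, div_zero, Nat.floor_zero] at hm
        omega
      rw [le_div_iff₀ hLpos] at h1
      have h2 : (T.card : ℝ) ≤ ((Fintype.card A ^ (n - m) : ℕ) : ℝ) := by
        rw [hpow, Nat.cast_sub hmn]
        refine hTcard.trans (Real.rpow_le_rpow_of_exponent_le one_le_two ?_)
        linarith
      exact_mod_cast h2
  obtain ⟨c, hc⟩ := exists_code_of_finset V hp0 hp (dp := Fintype.card A ^ m)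
    (dg := Fintype.card A ^ (n - m)) (pow_pos hd m)
    (by rw [← pow_add, Nat.add_sub_cancel' hmn]) T hTm hTprob
  refine ⟨c, ?_⟩
  have hmL : n * (L - H - δ / 2) - L ≤ m * L := by
    rcases hL0.eq_or_lt with h | h
    · rw [← h]
      nlinarith
    · have := (Nat.lt_floor_add_one (n * (L - H - δ / 2) / L)).le
      rw [← hm, div_le_iff₀ h] at this
      linarith
  have hLn : L ≤ n * (δ / 2) := by
    have h1 : 2 * L / δ ≤ n := hM.le.trans (by exact_mod_cast (by omega : M ≤ n))
    rw [div_le_iff₀ hδ] at h1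
    linarith
  rw [Code.rate, hc, hpow, Real.logb_rpow two_pos (by norm_num), one_div, ← div_eq_inv_mul,
    le_div_iff₀ hn0]
  linarith

theorem IsAchievable.le {A : Type*} [Fintype A] [DecidableEq A]
    {ρ : Matrix A A ℂ} (hρ : IsState ρ) {R : ℝ} (hR : IsAchievable ρ R) :
    R ≤ Real.logb 2 (Fintype.card A) - entropy ρ := by
  obtain ⟨V, p, hp0, hp, rfl⟩ := hρ.exists_eq_rotatedDiagonal
  -- One third of `δ` each for the slack in the rate, the deviation of the log-probabilities, and
  -- the constant factor `2 ^ (-2)` in the bound on the weight of a test.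
  refine le_of_forall_pos_le_add fun δ hδ => ?_
  have hδ3 : 0 < δ / 3 := by positivity
  obtain ⟨N, hN⟩ := exists_forall_weight_ge hp0 hp hδ3
  obtain ⟨N', hN'⟩ := hR (1 / 2) (by norm_num) (δ / 3) hδ3
  rw [entropy_rotatedDiagonal]
  set H := -∑ a, p a * Real.logb 2 (p a)
  obtain ⟨M, hM⟩ := exists_nat_gt (2 / (δ / 3))
  set n := N + N' + M + 1 with hn
  have hn0 : (0 : ℝ) < n := by exact_mod_cast (by omega : 0 < n)
  obtain ⟨c, hc⟩ := hN' n (by omega)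
  obtain ⟨w, hw0, hw1, hw, hws⟩ := c.exists_test
  have hdg := hN n (by omega) w hw0 hw1 hw
  rw [hws] at hdg
  have hdg0 : (0 : ℝ) < c.dg := lt_of_lt_of_le (by positivity) hdg
  have hdp0 : (0 : ℝ) < c.dp := by exact_mod_cast c.dp_pos
  rw [← Real.le_logb_iff_rpow_le one_lt_two hdg0] at hdg
  have hprod : Real.logb 2 c.dp + Real.logb 2 c.dg = n * Real.logb 2 (Fintype.card A) := by
    rw [← Real.logb_mul hdp0.ne' hdg0.ne', ← Nat.cast_mul, c.dp_mul_dg, Nat.cast_pow,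
      Real.logb_pow]
  have h2 : 2 ≤ n * (δ / 3) := by
    have h1 : 2 / (δ / 3) ≤ n := hM.le.trans (by exact_mod_cast (by omega : M ≤ n))
    rwa [div_le_iff₀ hδ3] at h1
  rw [Code.rate, one_div, ← div_eq_inv_mul, le_div_iff₀ hn0] at hc
  refine le_of_mul_le_mul_right ?_ hn0
  linarith

end Purity

/-- The purity of a state is a genuine (finite, non-vacuous) supremum, and it equals
`log d_A - H(A)_ρ`. -/
theorem theorem1 {A : Type*} [Fintype A] [DecidableEq A] (ρ : Matrix A A ℂ)
    (hρ : Purity.IsState ρ) :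
    IsLUB {R : ℝ | Purity.IsAchievable ρ R} (Purity.purity ρ) ∧
      Purity.purity ρ = Real.logb 2 (Fintype.card A) - Purity.entropy ρ := by
  have h : IsLUB {R : ℝ | Purity.IsAchievable ρ R}
      (Real.logb 2 (Fintype.card A) - Purity.entropy ρ) :=
    IsGreatest.isLUB ⟨Purity.isAchievable_logb_card_sub_entropy hρ, fun _ hR => hR.le hρ⟩
  have heq : Purity.purity ρ = Real.logb 2 (Fintype.card A) - Purity.entropy ρ :=
    h.csSup_eq ⟨_, Purity.isAchievable_logb_card_sub_entropy hρ⟩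
  exact ⟨heq ▸ h, heq⟩
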